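/- Let $p>3$ be a prime, let $n>1$ be an integer with $\gcd(n,p)=\gcd(n,p^2-1)=1$, and let $T_m$ denote the Chebyshev polynomial of the first kind of degree $m$ (so $T_0(X)=1$, $T_1(X)=X$, $T_m(X)=2X\,T_{m-1}(X)-T_{m-2}(X)$), with derivative $T_m'$. For $k\ge 1$ let $F_{p^k}$ be the functional graph of $T_n$ over $\mathbb{Z}/p^k\mathbb{Z}$, i.e. the directed graph on the vertex set $\mathbb{Z}/p^k\mathbb{Z}$ with an edge from $X$ to $Y$ if and only if $Y\equiv T_n(X) \pmod{p^k}$. Let $x\in\{0,1,\dots,p-1\}$, let $N_x$ be the least period of the sequence $(T_n^{i}(x) \bmod p)_{i\ge 0}$ of iterates of $T_n$, i.e. the least $N\ge 1$ with $T_n^{N}(x)\equiv x\pmod p$, let $l_x$ be the multiplicative order of $T'_{n^{N_x}}(x)$ modulo $p$, and let $$w=\max\{t\ge 0 : T'_{n^{N_x l_x}}(x)\equiv 1 \pmod{p^t}\}.$$ Then $w$ is well defined, $w\ge 1$, and $l_x\mid p-1$. The connected components of $F_{p^k}$ that contain a state $X$ with $(X \bmod p)\in\{T_n^j(x)\bmod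 p : 0\le j\le N_x-1\}$ consist precisely of all such states, each of these components is a directed cycle, and the family of these components is composed of the following cycles (where, if two of the listed lengths coincide, the corresponding numbers of cycles are added). If $k>w+1$: exactly $\frac{(p-1)p^{w-1}}{l_x}$ cycles of length $N_xl_xp^i$ for each $i\in\{1,2,\dots,k-w-1\}$, $\frac{p^w-1}{l_x}$ cycles of length $N_xl_x$, and one cycle of length $N_x$. If $k\le w+1$: exactly $\frac{p^{k-1}-1}{l_x}$ cycles of length $N_xl_x$ and one cycle of length $N_x$. -/

import Mathlib

/-- The map `X ↦ T_n(X)` on the ring `ℤ/mℤ`, where `T_n` is the Chebyshev polynomial of the first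
kind. -/
noncomputable def chebyshevMap (n m : ℕ) (X : ZMod m) : ZMod m :=
  (Polynomial.Chebyshev.T (ZMod m) (n : ℤ)).eval X

/-- The functional graph of `T_n` over `ℤ/mℤ`: there is an edge from `X` to `Y` if and only if
`Y = T_n(X)`. -/
def chebyshevGraph (n m : ℕ) : Digraph (ZMod m) where
  Adj X Y := Y = chebyshevMap n m X

/-- The vertex sets of the (weakly) connected components of a directed graph: two vertices lie in
the same component if they are joined by a path that disregards the direction of the edges. -/
def Digraph.weakComponents {V : Type*} (D : Digraph V) : Set (Set V) :=
  {C | ∃ X : V, C = {Y | Relation.EqvGen D.Adj X Y}}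

/-- The subgraph of `D` induced on `C` is a directed cycle of length `L ≥ 1` (a self-loop
if `L = 1`): its vertices can be listed without repetition as `v 0, …, v (L - 1)`, and its edges
are exactly those from `v i` to `v (i + 1)`, indices being read modulo `L`. -/
def Digraph.IsDirectedCycle {V : Type*} (D : Digraph V) (C : Set V) (L : ℕ) : Prop :=
  0 < L ∧ ∃ v : ZMod L → V, Function.Injective v ∧ Set.range v = C ∧
    ∀ i j : ZMod L, D.Adj (v i) (v j) ↔ j = i + 1

/-- The family `𝒞` of components of `D` consists of directed cycles, and `M` is the multiset of
their lengths: for each `L`, the number of cycles of length `L` is the multiplicity of `L`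
in `M`. -/
def Digraph.ComposedOfCycles {V : Type*} (D : Digraph V) (𝒞 : Set (Set V)) (M : Multiset ℕ) :
    Prop :=
  (∀ C ∈ 𝒞, ∃ L : ℕ, D.IsDirectedCycle C L) ∧
    ∀ L : ℕ, {C ∈ 𝒞 | D.IsDirectedCycle C L}.ncard = M.count L

/-- The value at the integer `x` of the derivative of the Chebyshev polynomial `T_m`. -/
noncomputable def chebyshevDeriv (m x : ℕ) : ℤ :=
  (Polynomial.derivative (Polynomial.Chebyshev.T ℤ (m : ℤ))).eval (x : ℤ)

/-- `N_x`: the least period of the sequence `T_n^i(x) mod p`, `i ≥ 0`. -/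
noncomputable def periodModP (p n x : ℕ) : ℕ :=
  Function.minimalPeriod (chebyshevMap n p) (x : ZMod p)

/-- `l_x`: the multiplicative order modulo `p` of the derivative of `T_{n^{N_x}}` at `x`. -/
noncomputable def derivOrder (p n x : ℕ) : ℕ :=
  orderOf (chebyshevDeriv (n ^ periodModP p n x) x : ZMod p)

/-- The exponents `t` such that the derivative of `T_{n^{N_x l_x}}` at `x` is congruent
to `1` modulo `p ^ t`. -/
def derivExponents (p n x : ℕ) : Set ℕ :=
  {t | chebyshevDeriv (n ^ (periodModP p n x * derivOrder p n x)) x ≡ 1 [ZMOD (p : ℤ) ^ t]}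

/-- The states of `ℤ/p^kℤ` whose reduction modulo `p` is one of `T_n^j(x) mod p`,
`0 ≤ j < N_x`. -/
def statesOver (p n x k : ℕ) : Set (ZMod (p ^ k)) :=
  {X | ∃ j < periodModP p n x, (X.val : ZMod p) = (chebyshevMap n p)^[j] (x : ZMod p)}

/-- The connected components of the functional graph of `T_n` over `ℤ/p^kℤ` that contain a state
of `statesOver p n x k`. -/
def componentsOver (p n x k : ℕ) : Set (Set (ZMod (p ^ k))) :=
  {C ∈ (chebyshevGraph n (p ^ k)).weakComponents | (C ∩ statesOver p n x k).Nonempty}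

/-! Write S_m = U_{m-1}, v for the p-adic valuation, N for the period of x modulo p and M = n^N, so
that T_M fixes the class of x modulo p. Everything rests on one formula (`IsLocalModel`): on this
class v(T_{M^r}(X) - X) = v(A^r - 1) + v(D(X)), where A is an integer prime to p and D is a
polynomial with a simple root modulo p at x. Hence the period of X modulo p^k is N if p^k divides
D(X), and otherwise N times the order of A modulo p^(k - v(D(X))). Lifting the exponent gives l *
p^max(i - w, 0) for the order modulo p^i, i ≥ 1. Since the root is simple, D maps the class
bijectively onto the multiples of p modulo p^k, so D vanishes at one point and k - v(D(X)) = i + 1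
holds at (p-1)p^i points when i + 1 < k. The derivative of T_{M^r} at x agrees with A^r to one more
power of p than divides A^r - 1, so it yields the same l and w as A.

The formula comes from T_{2b+1}(X) - X = 2(X^2-1) S_{b+1}(X) S_b(X); M is odd because n is prime to
the even number p^2 - 1. If x ≡ ±1, then v(S_q(X)) = v(q), and A = M^2, D = X^2 - 1 work. Otherwise
p divides exactly one of the last two factors at x; the sign in A = ±M is chosen so that A = 2b + 1
with p ∣ S_b(x), and D = S_ρ with ρ the prime-to-p part of b.

Coprimality of n with p^2 - 1 makes T_n a permutation modulo p; the formula and Euler's theorem then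
make every point modulo p^k periodic, and cycles are counted through their points. -/

/-- The value `T_m(X)` of the Chebyshev polynomial of the first kind at an integer. -/
noncomputable def chebT (m X : ℤ) : ℤ := (Polynomial.Chebyshev.T ℤ m).eval X

/-- The value `U_{m-1}(X)` of the Chebyshev polynomial of the second kind at an integer; the shift
of the index makes `m ↦ chebS m X` a divisibility sequence. -/
noncomputable def chebS (m X : ℤ) : ℤ := (Polynomial.Chebyshev.U ℤ (m - 1)).eval X

/-! ### Identities for Chebyshev values at integers -/

section Identities

variable (a b m X : ℤ)

@[simp] theorem chebT_zero : chebT 0 X = 1 := by simp [chebT]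
@[simp] theorem chebT_one : chebT 1 X = X := by simp [chebT]
@[simp] theorem chebS_zero : chebS 0 X = 0 := by simp [chebS]
@[simp] theorem chebS_one : chebS 1 X = 1 := by simp [chebS]
@[simp] theorem chebT_neg : chebT (-m) X = chebT m X := by simp [chebT]
@[simp] theorem chebS_neg : chebS (-m) X = -chebS m X := by
  simp [chebS, Polynomial.Chebyshev.U_neg_sub_one]

theorem chebT_add_two : chebT (m + 2) X = 2 * X * chebT (m + 1) X - chebT m X := by
  simp [chebT, Polynomial.Chebyshev.T_add_two]

theorem chebS_add_two : chebS (m + 2) X = 2 * X * chebS (m + 1) X - chebS m X := by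
  have h := Polynomial.Chebyshev.U_add_two ℤ (m - 1)
  rw [show m - 1 + 2 = m + 2 - 1 by ring, show m - 1 + 1 = m + 1 - 1 by ring] at h
  simp only [chebS, h]
  simp

/-- A sequence indexed by `ℤ` that satisfies the recurrence of the Chebyshev polynomials and
vanishes at `0` and `1` is zero. -/
theorem eq_zero_of_recurrence {Y : ℤ} {f : ℤ → ℤ} (h0 : f 0 = 0) (h1 : f 1 = 0)
    (h : ∀ n, f (n + 2) = 2 * Y * f (n + 1) - f n) (n : ℤ) : f n = 0 := by
  induction n using Polynomial.Chebyshev.induct with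
  | zero => exact h0
  | one => exact h1
  | add_two n ih1 ih2 => rw [h, ih1, ih2]; ring
  | neg_add_one n ih1 ih2 =>
    have := h (-n - 1)
    rw [show -(n : ℤ) - 1 + 2 = -n + 1 by ring, show -(n : ℤ) - 1 + 1 = -n by ring, ih1, ih2] at this
    linarith

theorem chebT_succ_and_chebS_succ :
    chebT (m + 1) X = X * chebT m X + (X ^ 2 - 1) * chebS m X ∧
      chebS (m + 1) X = X * chebS m X + chebT m X := by
  constructor
  · refine sub_eq_zero.1 (eq_zero_of_recurrence (Y := X)
      (f := fun m ↦ chebT (m + 1) X - (X * chebT m X + (X ^ 2 - 1) * chebS m X)) ?_ ?_ ?_ m)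
    · simp
    · have := chebT_add_two 0 X
      norm_num at this ⊢
      rw [this]; ring
    · intro n
      have h1 := chebT_add_two (n + 1) X
      rw [show n + 1 + 2 = n + 2 + 1 by ring] at h1
      simp only [h1, chebT_add_two n, chebS_add_two n]; ring
  · refine sub_eq_zero.1 (eq_zero_of_recurrence (Y := X)
      (f := fun m ↦ chebS (m + 1) X - (X * chebS m X + chebT m X)) ?_ ?_ ?_ m)
    · simp
    · have := chebS_add_two 0 X
      norm_num at this ⊢
      rw [this]; ring
    · intro n
      have h1 := chebS_add_two (n + 1) X
      rw [show n + 1 + 2 = n + 2 + 1 by ring] at h1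
      simp only [h1, chebT_add_two n, chebS_add_two n]; ring

theorem chebT_add :
    chebT (a + b) X = chebT a X * chebT b X + (X ^ 2 - 1) * chebS a X * chebS b X := by
  refine sub_eq_zero.1 (eq_zero_of_recurrence (Y := X) (f := fun b ↦ chebT (a + b) X -
    (chebT a X * chebT b X + (X ^ 2 - 1) * chebS a X * chebS b X)) ?_ ?_ ?_ b)
  · simp
  · simp [(chebT_succ_and_chebS_succ a X).1]; ring
  · intro n
    simp only [← add_assoc, chebT_add_two, chebS_add_two]; ring

theorem chebS_add : chebS (a + b) X = chebS a X * chebT b X + chebT a X * chebS b X := by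
  refine sub_eq_zero.1 (eq_zero_of_recurrence (Y := X) (f := fun b ↦ chebS (a + b) X -
    (chebS a X * chebT b X + chebT a X * chebS b X)) ?_ ?_ ?_ b)
  · simp
  · simp [(chebT_succ_and_chebS_succ a X).2]; ring
  · intro n
    simp only [← add_assoc, chebT_add_two, chebS_add_two]; ring

theorem chebT_sub :
    chebT (a - b) X = chebT a X * chebT b X - (X ^ 2 - 1) * chebS a X * chebS b X := by
  rw [sub_eq_add_neg, chebT_add]; simp; ring

theorem chebS_sub : chebS (a - b) X = chebS a X * chebT b X - chebT a X * chebS b X := by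
  rw [sub_eq_add_neg, chebS_add]; simp; ring

theorem chebT_sq : chebT m X ^ 2 = 1 + (X ^ 2 - 1) * chebS m X ^ 2 := by
  have := chebT_sub m m X
  simp at this
  linear_combination -this

/-- As functions of `b`, both sides satisfy the recurrence with parameter `chebT a X`, by adding the
formulas for indices a(b+1) ± a. -/
theorem chebS_mul : chebS (a * b) X = chebS a X * chebS b (chebT a X) := by
  refine sub_eq_zero.1 (eq_zero_of_recurrence (Y := chebT a X) (f := fun b ↦ chebS (a * b) X -
    chebS a X * chebS b (chebT a X)) ?_ ?_ ?_ b)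
  · simp
  · simp
  · intro n
    have h1 := chebS_add (a * (n + 1)) a X
    have h2 := chebS_sub (a * (n + 1)) a X
    rw [show a * (n + 1) + a = a * (n + 2) by ring] at h1
    rw [show a * (n + 1) - a = a * n by ring] at h2
    simp only [chebS_add_two]
    linear_combination h1 + h2

theorem chebT_mul : chebT (a * b) X = chebT a (chebT b X) := by
  simp [chebT, Polynomial.Chebyshev.T_mul]

theorem chebS_dvd_chebS {a b : ℤ} (h : a ∣ b) : chebS a X ∣ chebS b X := by
  obtain ⟨c, rfl⟩ := h
  exact ⟨_, chebS_mul a c X⟩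

theorem derivative_T_eval :
    (Polynomial.derivative (Polynomial.Chebyshev.T ℤ m)).eval X = m * chebS m X := by
  simp [Polynomial.Chebyshev.T_derivative_eq_U, chebS]

theorem derivative_U_eval : (X ^ 2 - 1) *
    (Polynomial.derivative (Polynomial.Chebyshev.U ℤ (m - 1))).eval X =
      m * chebT m X - X * chebS m X := by
  have := congrArg (Polynomial.eval X) (Polynomial.Chebyshev.add_one_mul_T_eq_poly_in_U (R := ℤ) (m - 1))
  simp at this
  simp only [chebS, chebT]
  linear_combination -this

/-- Subtract the formulas for T_{(b+1)+b} and T_{(b+1)-b} = X. The factors separate the ways in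
which X can be fixed by a T of odd index. -/
theorem chebT_two_mul_add_one_sub_self :
    chebT (2 * b + 1) X - X = 2 * (X ^ 2 - 1) * chebS (b + 1) X * chebS b X := by
  have h1 := chebT_add (b + 1) b X
  have h2 := chebT_sub (b + 1) b X
  rw [show b + 1 + b = 2 * b + 1 by ring] at h1
  rw [show b + 1 - b = 1 by ring, chebT_one] at h2
  linear_combination h1 - h2

theorem mul_chebS_two_mul_add_one_sub_one :
    (2 * b + 1) * chebS (2 * b + 1) X - 1 =
      2 * (b + 1) * (chebT (b + 1) X * chebS b X) + 2 * b * (chebS (b + 1) X * chebT b X) := by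
  have h1 := chebS_add (b + 1) b X
  have h2 := chebS_sub (b + 1) b X
  rw [show b + 1 + b = 2 * b + 1 by ring] at h1
  rw [show b + 1 - b = 1 by ring, chebS_one] at h2
  linear_combination (2 * b + 1) * h1 - h2

end Identities

/-! ### Divisibility of Chebyshev values by powers of p -/

section Congruences

variable {p : ℕ} {X Y : ℤ}

theorem chebT_modEq {N : ℤ} (h : X ≡ Y [ZMOD N]) (m : ℤ) : chebT m X ≡ chebT m Y [ZMOD N] :=
  (Int.modEq_iff_dvd.2 ((Int.modEq_iff_dvd.1 h).trans (Polynomial.sub_dvd_eval_sub _ _ _)))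

theorem chebS_modEq {N : ℤ} (h : X ≡ Y [ZMOD N]) (m : ℤ) : chebS m X ≡ chebS m Y [ZMOD N] :=
  (Int.modEq_iff_dvd.2 ((Int.modEq_iff_dvd.1 h).trans (Polynomial.sub_dvd_eval_sub _ _ _)))

theorem chebS_one_right (m : ℤ) : chebS m 1 = m := by simp [chebS]

/-- First-order Taylor expansion at 1, where the derivative of U_{n-1} is (n^3 - n)/3; the factor 3
clears the denominator, whence the need for p > 3 later. -/
theorem three_mul_chebS_one_add (h : ℤ) (n : ℕ) :
    3 * chebS n (1 + h) ≡ 3 * n + h * ((n : ℤ) ^ 3 - n) [ZMOD h ^ 2] := by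
  induction n using Nat.twoStepInduction with
  | zero => simp
  | one => simp
  | more n ih1 ih2 =>
    obtain ⟨c, hc⟩ := (Int.modEq_iff_dvd.1 ih1)
    obtain ⟨d, hd⟩ := (Int.modEq_iff_dvd.1 ih2)
    refine Int.modEq_iff_dvd.2 ⟨2 * (1 + h) * d - c - 2 * ((n + 1 : ℤ) ^ 3 - (n + 1)), ?_⟩
    have := chebS_add_two n (1 + h)
    push_cast at hc hd this ⊢
    linear_combination 2 * (1 + h) * hd - hc - 3 * this

theorem chebS_prime_modEq (hp : p.Prime) (hp3 : 3 < p) (hX : (p : ℤ) ∣ X - 1) :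
    (p : ℤ) ^ 2 ∣ chebS p X - p := by
  have hpp := Nat.prime_iff_prime_int.1 hp
  obtain ⟨c, hc⟩ := hX
  have h := (Int.modEq_iff_dvd.1 (three_mul_chebS_one_add (X - 1) p).symm)
  rw [add_sub_cancel, hc] at h
  have h1 : (p : ℤ) ^ 2 ∣ 3 * (chebS p X - p) := by
    obtain ⟨d, hd⟩ := h
    exact ⟨c ^ 2 * d + c * (p ^ 2 - 1), by linear_combination hd⟩
  refine IsCoprime.dvd_of_dvd_mul_left (IsCoprime.pow_left ?_) h1
  refine (hpp.coprime_iff_not_dvd).2 fun h3 ↦ ?_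
  have := Nat.le_of_dvd (by norm_num) (by exact_mod_cast h3 : p ∣ 3)
  omega

theorem pow_succ_dvd_chebS_sub (hp : p.Prime) (hp3 : 3 < p) (hX : (p : ℤ) ∣ X - 1) (j : ℕ) {q : ℤ}
    (hq : (p : ℤ) ^ j ∣ q) : (p : ℤ) ^ (j + 1) ∣ chebS q X - q := by
  have h1 : X ≡ 1 [ZMOD p] := (Int.modEq_iff_dvd.2 hX).symm
  induction j generalizing q with
  | zero =>
    have := Int.modEq_iff_dvd.1 (chebS_modEq h1 q).symm
    rw [chebS_one_right] at this
    simpa using this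
  | succ j ih =>
    obtain ⟨e, he⟩ := hq
    obtain ⟨c, hc⟩ := ih (q := p ^ j * e) (dvd_mul_right _ _)
    have hT : (p : ℤ) ∣ chebT (p ^ j * e) X - 1 := by
      have := Int.modEq_iff_dvd.1 (chebT_modEq h1 (p ^ j * e)).symm
      simpa [chebT] using this
    obtain ⟨d, hd⟩ := chebS_prime_modEq hp hp3 hT
    have := chebS_mul (p ^ j * e) p X
    rw [he, show (p : ℤ) ^ (j + 1) * e = p ^ j * e * p by ring, this]
    refine ⟨c + e * d + p * c * d, ?_⟩
    rw [eq_add_of_sub_eq hc, eq_add_of_sub_eq hd]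
    ring

theorem emultiplicity_eq_of_forall_pow_dvd_sub {P s q : ℤ}
    (h : ∀ j : ℕ, P ^ j ∣ q → P ^ (j + 1) ∣ s - q) : emultiplicity P s = emultiplicity P q := by
  refine emultiplicity_eq_emultiplicity_iff.2 fun j ↦ ⟨fun hj ↦ ?_, fun hj ↦ ?_⟩
  -- The hypothesis at level i needs P^i ∣ q first, so the powers are gained one at a time.
  · suffices ∀ i ≤ j, P ^ i ∣ q from this j le_rfl
    intro i
    induction i with
    | zero => simp
    | succ i ih =>
      intro hi
      have := (pow_dvd_pow P hi).trans hj
      exact (dvd_sub_right this).1 (h i (ih (by omega)))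
  · have := (pow_dvd_pow P (Nat.le_succ j)).trans (h j hj)
    exact (dvd_sub_left hj).1 this

/-- If `X ≡ ±1` modulo `p`, then `U_{q-1}(X)` and `q` are divisible by the same powers of `p`. -/
theorem emultiplicity_chebS_of_dvd_sq_sub_one (hp : p.Prime) (hp3 : 3 < p)
    (hX : (p : ℤ) ∣ X ^ 2 - 1) (q : ℤ) :
    emultiplicity (p : ℤ) (chebS q X) = emultiplicity (p : ℤ) q := by
  have hpp := Nat.prime_iff_prime_int.1 hp
  have h2T : chebT 2 X = 2 * X ^ 2 - 1 := by
    have := chebT_add_two 0 X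
    norm_num at this; linarith
  have h2S (Y : ℤ) : chebS 2 Y = 2 * Y := by
    have := chebS_add_two 0 Y
    norm_num at this; linarith
  -- Expanding S_{2q} in two ways gives S_q(X) T_q(X) = X S_q(T_2(X)). Here X and T_q(X) are prime
  -- to p, and T_2(X) = 2X^2 - 1 ≡ 1, which reduces ±1 to 1.
  have key := chebS_mul 2 q X
  rw [mul_comm, chebS_mul, h2S, h2S] at key
  have h0 {z : ℤ} (hz : (p : ℤ) ∣ z ^ 2 - 1) : emultiplicity (p : ℤ) z = 0 := by
    refine emultiplicity_eq_zero.2 fun h ↦ hpp.not_dvd_one ?_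
    exact (dvd_sub_right (dvd_pow h two_ne_zero)).1 hz
  have hTq : (p : ℤ) ∣ chebT q X ^ 2 - 1 := by
    rw [chebT_sq]
    exact (hX.mul_right (chebS q X ^ 2)).trans (by ring_nf; rfl)
  have h3 : emultiplicity (p : ℤ) (chebS q (chebT 2 X)) = emultiplicity (p : ℤ) q := by
    refine emultiplicity_eq_of_forall_pow_dvd_sub fun j hj ↦ pow_succ_dvd_chebS_sub hp hp3 ?_ j hj
    rw [h2T]
    exact (hX.mul_left 2).trans (by ring_nf; rfl)
  have key' : chebS q X * chebT q X = X * chebS q (chebT 2 X) := by linarith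
  have := congrArg (emultiplicity (p : ℤ)) key'
  rwa [emultiplicity_mul hpp, emultiplicity_mul hpp, h0 hTq, h0 hX, h3, add_zero, zero_add] at this

/-- Pell's equation. It places T_r(X) at ±1 modulo p, where the valuation of S_q(T_r(X)) is known.
-/
theorem dvd_chebT_sq_sub_one {P r : ℤ} (h : P ∣ chebS r X) : P ∣ chebT r X ^ 2 - 1 := by
  rw [chebT_sq, add_sub_cancel_left]
  exact (dvd_pow h two_ne_zero).mul_left _

/-- Lifting the exponent for Chebyshev polynomials of the second kind. -/
theorem emultiplicity_chebS_mul (hp : p.Prime) (hp3 : 3 < p) {r : ℤ}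
    (h : (p : ℤ) ∣ chebS r X) (q : ℤ) : emultiplicity (p : ℤ) (chebS (r * q) X) =
      emultiplicity (p : ℤ) (chebS r X) + emultiplicity (p : ℤ) q := by
  rw [chebS_mul, emultiplicity_mul (Nat.prime_iff_prime_int.1 hp),
    emultiplicity_chebS_of_dvd_sq_sub_one hp hp3 (dvd_chebT_sq_sub_one h)]

/-- The Dickson polynomial of prime index p is X^p modulo p, and at 2X it equals 2 T_p(X); Fermat's
little theorem does the rest. -/
theorem dvd_chebT_prime_sub_self (hp : p.Prime) (hp3 : 3 < p) (X : ℤ) :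
    (p : ℤ) ∣ chebT p X - X := by
  have := Fact.mk hp
  have h2 : (2 : ZMod p) ≠ 0 := by
    intro h
    have := (ZMod.natCast_eq_zero_iff 2 p).1 (by exact_mod_cast h)
    have := Nat.le_of_dvd (by norm_num) this
    omega
  have h1 : (X : ZMod p) = (Polynomial.Chebyshev.T (ZMod p) p).eval (X : ZMod p) := by
    have h := congrArg (Polynomial.eval (X : ZMod p))
      (Polynomial.Chebyshev.C_comp_two_mul_X (ZMod p) p)
    rw [← Polynomial.dickson_one_one_eq_chebyshev_C, Polynomial.dickson_one_one_zmod_p] at h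
    simp [ZMod.pow_card] at h
    exact h.resolve_right h2
  refine (ZMod.intCast_zmod_eq_zero_iff_dvd _ _).1 ?_
  have h3 := Polynomial.Chebyshev.algebraMap_eval_T (R := ℤ) (R' := ZMod p) X p
  simp only [algebraMap_int_eq, eq_intCast] at h3
  push_cast
  rw [chebT, h3, ← h1, sub_self]

theorem dvd_sq_sub_one_of_dvd_chebS_prime (hp : p.Prime) (hp3 : 3 < p)
    (h : (p : ℤ) ∣ chebS p X) : (p : ℤ) ∣ X ^ 2 - 1 := by
  have h1 := dvd_chebT_sq_sub_one h
  have h2 := (dvd_chebT_prime_sub_self hp hp3 X).mul_right (chebT p X + X)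
  have := dvd_sub h1 h2
  ring_nf at this ⊢
  exact this

/-- Away from ±1, a factor p of the index creates no new zero: p ∣ S_p(T) forces T^2 ≡ 1, and Pell's
equation turns this back into divisibility of the earlier S. -/
theorem dvd_chebS_of_dvd_chebS_mul_pow (hp : p.Prime) (hp3 : 3 < p) (hX : ¬(p : ℤ) ∣ X ^ 2 - 1)
    {r : ℤ} (e : ℕ) (h : (p : ℤ) ∣ chebS (r * p ^ e) X) : (p : ℤ) ∣ chebS r X := by
  have hpp := Nat.prime_iff_prime_int.1 hp
  induction e with
  | zero => simpa using h
  | succ e ih =>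
    refine ih ?_
    rw [pow_succ, ← mul_assoc, chebS_mul] at h
    refine (hpp.dvd_or_dvd h).elim id fun h ↦ ?_
    have h1 := dvd_sq_sub_one_of_dvd_chebS_prime hp hp3 h
    rw [chebT_sq, add_sub_cancel_left] at h1
    exact hpp.dvd_of_dvd_pow ((hpp.dvd_or_dvd h1).resolve_left hX)

end Congruences

/-! ### The multiplicative model of T_M near a fixed class -/

section LocalModel

variable {p : ℕ} {X x : ℤ}

theorem chebS_neg_right {m : ℕ} (hm : Odd m) (X : ℤ) : chebS m (-X) = chebS m X := by
  obtain ⟨b, rfl⟩ := hm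
  have := Polynomial.Chebyshev.U_eval_neg (R := ℤ) (2 * b) X
  have h2 : ((2 * b + 1 : ℕ) : ℤ) - 1 = (2 * b : ℕ) := by push_cast; ring
  rw [chebS, chebS, h2, this, Int.negOnePow_even _ (by push_cast; exact even_two_mul _)]
  simp

theorem emultiplicity_two_of_three_lt (hp3 : 3 < p) :
    emultiplicity (p : ℤ) 2 = 0 := by
  refine emultiplicity_eq_zero.2 fun h ↦ ?_
  have := Nat.le_of_dvd (by norm_num) (by exact_mod_cast h : p ∣ 2)
  omega

theorem not_dvd_chebS_add_one {P b : ℤ} (hP : Prime P) (h : P ∣ chebS b X) :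
    ¬P ∣ chebS (b + 1) X := by
  intro h'
  have h2 := chebS_sub (b + 1) b X
  rw [show b + 1 - b = 1 by ring, chebS_one] at h2
  exact hP.not_dvd_one (h2 ▸ dvd_sub (h'.mul_right _) (h.mul_left _))

theorem dvd_mul_chebS_sub_of_dvd_chebS {P b : ℤ} (h : P ∣ chebS b X) :
    P ∣ (2 * b + 1) * chebS (2 * b + 1) X - (2 * b + 1) := by
  have h2 := chebS_sub (b + 1) b X
  rw [show b + 1 - b = 1 by ring, chebS_one] at h2
  have h3 := mul_chebS_two_mul_add_one_sub_one b X
  refine (h.mul_left (2 * (2 * b + 1) * chebT (b + 1) X)).trans (dvd_of_eq ?_)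
  linear_combination 2 * b * h2 - h3

theorem pow_succ_dvd_mul_chebS_sub_sq (hp : p.Prime) (hp3 : 3 < p) (hX : (p : ℤ) ∣ X - 1) {b : ℤ}
    {j : ℕ} (h : (p : ℤ) ^ j ∣ (2 * b + 1) ^ 2 - 1) :
    (p : ℤ) ^ (j + 1) ∣ (2 * b + 1) * chebS (2 * b + 1) X - (2 * b + 1) ^ 2 := by
  have hpp := Nat.prime_iff_prime_int.1 hp
  have h1 : X ≡ 1 [ZMOD p] := (Int.modEq_iff_dvd.2 hX).symm
  have hT (m : ℤ) : (p : ℤ) ∣ chebT m X - 1 := by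
    have := Int.modEq_iff_dvd.1 (chebT_modEq h1 m).symm
    simpa [chebT] using this
  have hS (m : ℤ) : (p : ℤ) ∣ chebS m X - m := by
    simpa using pow_succ_dvd_chebS_sub hp hp3 hX 0 (q := m) (by simp)
  -- (2b+1)^2 - 1 = 4b(b+1), and b and b+1 are coprime. The chosen factor is then known modulo
  -- p^(j+1), and the other quantities are needed only modulo p.
  have hb : (p : ℤ) ^ j ∣ b ∨ (p : ℤ) ^ j ∣ b + 1 := by
    have h4 : (p : ℤ) ^ j ∣ b * (b + 1) := by
      have h5 : IsCoprime ((p : ℤ) ^ j) 4 := by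
        refine IsCoprime.pow_left (hpp.coprime_iff_not_dvd.2 fun h ↦ ?_)
        have h6 : (p : ℤ) ∣ 2 := hpp.dvd_of_dvd_pow (n := 2) (by norm_num; exact h)
        have := emultiplicity_eq_zero.1 (emultiplicity_two_of_three_lt hp3)
        exact this h6
      refine h5.dvd_of_dvd_mul_left (h.trans (dvd_of_eq (by ring)))
    by_cases h6 : (p : ℤ) ∣ b
    · left
      refine IsCoprime.dvd_of_dvd_mul_right (IsCoprime.pow_left ?_) h4
      exact hpp.coprime_iff_not_dvd.2 fun h7 ↦ hpp.not_dvd_one ((dvd_add_right h6).1 h7)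
    · right
      exact IsCoprime.dvd_of_dvd_mul_left (IsCoprime.pow_left (hpp.coprime_iff_not_dvd.2 h6)) h4
  have h3 := mul_chebS_two_mul_add_one_sub_one b X
  obtain ⟨t, ht⟩ := hT b
  obtain ⟨u, hu⟩ := hT (b + 1)
  rcases hb with hb | hb
  · obtain ⟨c, hc⟩ := pow_succ_dvd_chebS_sub hp hp3 hX j hb
    obtain ⟨d, hd⟩ := hS (b + 1)
    obtain ⟨e, he⟩ := hb
    refine ⟨2 * (b + 1) * e * u + 2 * (b + 1) * chebT (b + 1) X * c +
      2 * e * d * chebT b X + 2 * e * (b + 1) * t, ?_⟩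
    have hs := eq_add_of_sub_eq hc
    have hs' := eq_add_of_sub_eq hd
    have hu' := eq_add_of_sub_eq hu
    have ht' := eq_add_of_sub_eq ht
    rw [eq_add_of_sub_eq h3, hs, hs', hu', ht']
    linear_combination (2 * (b + 1) * p * u + 2 * p * d * (p * t + 1) + 2 * (b + 1) * p * t) * he
  · obtain ⟨c, hc⟩ := pow_succ_dvd_chebS_sub hp hp3 hX j hb
    obtain ⟨d, hd⟩ := hS b
    obtain ⟨e, he⟩ := hb
    refine ⟨2 * b * e * t + 2 * b * chebT b X * c +
      2 * e * d * chebT (b + 1) X + 2 * e * b * u, ?_⟩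
    have hs := eq_add_of_sub_eq hc
    have hs' := eq_add_of_sub_eq hd
    have hu' := eq_add_of_sub_eq hu
    have ht' := eq_add_of_sub_eq ht
    rw [eq_add_of_sub_eq h3, hs, hs', hu', ht']
    linear_combination (2 * b * p * u + 2 * p * d * (p * u + 1) + 2 * b * p * t) * he

/-- The local data of the map `T_M` at a residue class modulo `p` that it fixes: on this class,
the iterates of `T_M` behave like the powers of the multiplication by `A`, the distance to the
fixed point being measured by the polynomial `D`. -/
structure IsLocalModel (p M : ℕ) (x : ℤ) (D : Polynomial ℤ) (A : ℤ) : Prop where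
  not_dvd : ¬(p : ℤ) ∣ A
  one_lt : 1 < A.natAbs
  dvd_eval : (p : ℤ) ∣ D.eval x
  not_dvd_derivative : ¬(p : ℤ) ∣ D.derivative.eval x
  emultiplicity_eq : ∀ (r : ℕ) (X : ℤ), (p : ℤ) ∣ X - x →
    emultiplicity (p : ℤ) (chebT ((M : ℤ) ^ r) X - X) =
      emultiplicity (p : ℤ) (A ^ r - 1) + emultiplicity (p : ℤ) (D.eval X)
  derivative_sub : ∀ r j : ℕ, (p : ℤ) ^ j ∣ A ^ r - 1 →
    (p : ℤ) ^ (j + 1) ∣ (M : ℤ) ^ r * chebS ((M : ℤ) ^ r) x - A ^ r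

theorem dvd_sq_sub_one_iff {P : ℤ} (h : P ∣ X - x) : P ∣ X ^ 2 - 1 ↔ P ∣ x ^ 2 - 1 := by
  have : P ∣ (X ^ 2 - 1) - (x ^ 2 - 1) := (h.mul_right (X + x)).trans (dvd_of_eq (by ring))
  exact dvd_iff_dvd_of_dvd_sub this

theorem exists_isLocalModel_of_dvd (hp : p.Prime) (hp3 : 3 < p) {M : ℕ} (hM : Odd M)
    (hM1 : 1 < M) (hpM : ¬p ∣ M) (hx : (p : ℤ) ∣ x ^ 2 - 1) :
    ∃ D A, IsLocalModel p M x D A := by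
  have hpp := Nat.prime_iff_prime_int.1 hp
  have h2 := emultiplicity_two_of_three_lt hp3
  have hx' : ¬(p : ℤ) ∣ x := fun h ↦ hpp.not_dvd_one ((dvd_sub_right (dvd_pow h two_ne_zero)).1 hx)
  refine ⟨Polynomial.X ^ 2 - 1, (M : ℤ) ^ 2, ?_, ?_, by simpa using hx, ?_, ?_, ?_⟩
  · exact fun h ↦ hpM (by exact_mod_cast hpp.dvd_of_dvd_pow h)
  · rw [Int.natAbs_pow, Int.natAbs_natCast]
    exact Nat.one_lt_pow two_ne_zero hM1
  · intro h
    simp at h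
    rcases hpp.dvd_or_dvd h with h | h
    · exact emultiplicity_eq_zero.1 h2 h
    · exact hx' h
  · intro r X hX
    obtain ⟨b, hb⟩ : Odd ((M : ℤ) ^ r) := by exact_mod_cast hM.pow
    have hX1 := (dvd_sq_sub_one_iff hX).2 hx
    have e : ((M : ℤ) ^ 2) ^ r - 1 = 2 * (2 * ((b + 1) * b)) := by
      rw [pow_right_comm, hb]; ring
    rw [e, hb, chebT_two_mul_add_one_sub_self]
    simp only [emultiplicity_mul hpp, h2, emultiplicity_chebS_of_dvd_sq_sub_one hp hp3 hX1]
    simp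
    ring
  · intro r j h
    have hodd : Odd (M ^ r) := hM.pow
    rw [pow_right_comm] at h ⊢
    obtain ⟨b, hb⟩ : Odd ((M : ℤ) ^ r) := by exact_mod_cast hM.pow
    have : (p : ℤ) ∣ (x - 1) * (x + 1) := hx.trans (dvd_of_eq (by ring))
    rcases hpp.dvd_or_dvd this with h1 | h1
    · rw [hb] at h ⊢
      exact pow_succ_dvd_mul_chebS_sub_sq hp hp3 h1 h
    -- At x ≡ -1, pass to -x ≡ 1: S of odd index is an even function.
    · have h3 := chebS_neg_right hodd x
      push_cast at h3
      rw [← h3]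
      rw [hb] at h ⊢
      refine pow_succ_dvd_mul_chebS_sub_sq hp hp3 (dvd_neg.1 ?_) h
      exact h1.trans (dvd_of_eq (by ring))

theorem exists_isLocalModel_of_not_dvd (hp : p.Prime) (hp3 : 3 < p) {M : ℕ} (hM : Odd M)
    (hM1 : 1 < M) (hpM : ¬p ∣ M) (hx : ¬(p : ℤ) ∣ x ^ 2 - 1) (hxM : (p : ℤ) ∣ chebT M x - x) :
    ∃ D A, IsLocalModel p M x D A := by
  have hpp := Nat.prime_iff_prime_int.1 hp
  have h2 := emultiplicity_two_of_three_lt hp3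
  have h2' := emultiplicity_eq_zero.1 h2
  obtain ⟨b, A, hA, hb, hS⟩ : ∃ b A : ℤ, (A = M ∨ A = -M) ∧ A = 2 * b + 1 ∧
      (p : ℤ) ∣ chebS b x := by
    obtain ⟨b, hb⟩ := hM
    have hb' : (M : ℤ) = 2 * b + 1 := by exact_mod_cast hb
    rw [hb', chebT_two_mul_add_one_sub_self] at hxM
    rcases hpp.dvd_or_dvd hxM with h | h
    · rcases hpp.dvd_or_dvd h with h | h
      · exact absurd h (by simp [hpp.dvd_mul, h2', hx])
      -- -M = 2(-(b+1)) + 1, so a zero of S_{b+1} becomes one of S_b after a change of sign of M.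
      · exact ⟨-(b + 1), -M, Or.inr rfl, by rw [hb']; ring, by
          rw [chebS_neg]; exact (dvd_neg.2 h)⟩
    · exact ⟨b, M, Or.inl rfl, hb', h⟩
  have hAabs : A.natAbs = M := by rcases hA with h | h <;> simp [h]
  have hb0 : b ≠ 0 := by
    rintro rfl
    simp at hb
    simp [hb] at hAabs
    omega
  obtain ⟨ρ, hρ, hpρ⟩ := FiniteMultiplicity.exists_eq_pow_mul_and_not_dvd
    (Int.finiteMultiplicity_iff.2 ⟨by simpa using hp.ne_one, hb0⟩ : FiniteMultiplicity (p : ℤ) b)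
  set e := multiplicity (p : ℤ) b
  have hSρ : (p : ℤ) ∣ chebS ρ x := by
    refine dvd_chebS_of_dvd_chebS_mul_pow hp hp3 hx e ?_
    rwa [mul_comm, ← hρ]
  -- A - 1 = 2b divides A^r - 1, so the half-index of A^r is a multiple of b = p^e ρ, and S_ρ
  -- divides the corresponding S.
  have hr (r : ℕ) : ∃ c : ℤ, A ^ r = 2 * (ρ * (p ^ e * c)) + 1 := by
    have : A - 1 ∣ A ^ r - 1 := by simpa using sub_dvd_pow_sub_pow A 1 r
    obtain ⟨c, hc⟩ := this
    refine ⟨c, ?_⟩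
    rw [hb] at hc ⊢
    linear_combination hc + 2 * c * hρ
  have hpow (r : ℕ) : A ^ r = (M : ℤ) ^ r ∨ A ^ r = -(M : ℤ) ^ r := by
    rcases hA with h | h
    · simp [h]
    · rw [h, neg_pow]
      rcases neg_one_pow_eq_or ℤ r with h | h <;> simp [h]
  have hv (c : ℤ) : emultiplicity (p : ℤ) (2 * (ρ * (p ^ e * c)) + 1 - 1) =
      emultiplicity (p : ℤ) (p ^ e * c) := by
    rw [add_sub_cancel_right, emultiplicity_mul hpp, emultiplicity_mul hpp, h2,
      emultiplicity_eq_zero.2 hpρ, zero_add, zero_add]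
  refine ⟨Polynomial.Chebyshev.U ℤ (ρ - 1), A, ?_, ?_, hSρ, ?_, ?_, ?_⟩
  · rw [← Int.dvd_natAbs, hAabs]
    exact_mod_cast hpM
  · rwa [hAabs]
  · intro h
    have h1 := derivative_U_eval ρ x
    have h3 : (p : ℤ) ∣ ρ * chebT ρ x := by
      have h4 := h.mul_left (x ^ 2 - 1)
      rw [h1] at h4
      exact (dvd_sub_left (hSρ.mul_left x)).1 h4
    have h4 := (hpp.dvd_or_dvd h3).resolve_left hpρ
    exact hpp.not_dvd_one ((dvd_sub_right (dvd_pow h4 two_ne_zero)).1 (dvd_chebT_sq_sub_one hSρ))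
  · intro r X hX
    obtain ⟨c, hc⟩ := hr r
    have hSX : (p : ℤ) ∣ chebS ρ X := by
      have := Int.modEq_iff_dvd.1 (chebS_modEq (Int.modEq_iff_dvd.2 hX) ρ)
      exact (dvd_iff_dvd_of_dvd_sub this).2 hSρ
    have hSX' : (p : ℤ) ∣ chebS (ρ * (p ^ e * c)) X :=
      hSX.trans (chebS_dvd_chebS X (dvd_mul_right _ _))
    have hT : chebT ((M : ℤ) ^ r) X = chebT (A ^ r) X := by
      rcases hpow r with h | h <;> simp [h]
    rw [hT, hc, chebT_two_mul_add_one_sub_self, hv]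
    simp only [emultiplicity_mul hpp (a := _ * chebS _ _),
      emultiplicity_mul hpp (a := 2 * _), emultiplicity_mul hpp (a := 2), h2,
      emultiplicity_eq_zero.2 (not_dvd_chebS_add_one hpp hSX'),
      emultiplicity_eq_zero.2 (mt (dvd_sq_sub_one_iff hX).1 hx),
      emultiplicity_chebS_mul hp hp3 hSX]
    simp only [zero_add]
    rw [add_comm]
    rfl
  · intro r j h
    obtain ⟨c, hc⟩ := hr r
    have hS' : (M : ℤ) ^ r * chebS ((M : ℤ) ^ r) x = A ^ r * chebS (A ^ r) x := by
      rcases hpow r with h | h <;> simp [h]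
    rw [hS', hc]
    rw [hc] at h
    -- The extra power of p beyond j comes from p ∣ S_ρ(x).
    refine dvd_mul_chebS_sub_of_dvd_chebS (pow_dvd_of_le_emultiplicity ?_)
    rw [emultiplicity_chebS_mul hp hp3 hSρ, ← hv, add_comm j]
    push_cast
    refine add_le_add ?_ (le_emultiplicity_of_pow_dvd h)
    exact_mod_cast le_emultiplicity_of_pow_dvd (k := 1) (by simpa using hSρ)

theorem exists_isLocalModel (hp : p.Prime) (hp3 : 3 < p) {M : ℕ} (hM : Odd M)
    (hM1 : 1 < M) (hpM : ¬p ∣ M) (hxM : (p : ℤ) ∣ chebT M x - x) :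
    ∃ D A, IsLocalModel p M x D A := by
  by_cases hx : (p : ℤ) ∣ x ^ 2 - 1
  · exact exists_isLocalModel_of_dvd hp hp3 hM hM1 hpM hx
  · exact exists_isLocalModel_of_not_dvd hp hp3 hM hM1 hpM hx hxM

/-- If `n` is prime to `p ^ 2 - 1`, then `T_n` has a left inverse modulo `p`. -/
theorem exists_dvd_chebT_chebT_sub_self (hp : p.Prime) (hp3 : 3 < p) {n : ℕ}
    (hn : n.Coprime (p ^ 2 - 1)) : ∃ m : ℤ, ∀ X : ℤ, (p : ℤ) ∣ chebT m (chebT n X) - X := by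
  have hpp := Nat.prime_iff_prime_int.1 hp
  have hodd : Odd (p : ℤ) := by exact_mod_cast hp.odd_of_ne_two (by omega)
  obtain ⟨q, hq⟩ := hodd
  -- With p = 2q + 1, p^2 - 1 = 4q(q+1). A Bézout inverse u of n makes T_u the left inverse, as
  -- T_p(X) ≡ X forces p to divide (X^2-1) S_{q(q+1)}(X).
  have h1 : IsCoprime (n : ℤ) (4 * (q * (q + 1))) := by
    have := Nat.isCoprime_iff_coprime.2 hn
    rw [Nat.cast_sub (Nat.one_le_pow _ _ hp.pos)] at this
    push_cast at this
    rw [hq] at this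
    convert this using 1
    ring
  obtain ⟨u, v, huv⟩ := h1
  refine ⟨u, fun X ↦ ?_⟩
  rw [← chebT_mul]
  have e : u * n = 2 * (q * (q + 1) * (-2 * v)) + 1 := by linear_combination huv
  have hd : (p : ℤ) ∣ (X ^ 2 - 1) * chebS (q * (q + 1) * (-2 * v)) X := by
    have h2 := dvd_chebT_prime_sub_self hp hp3 X
    rw [hq, chebT_two_mul_add_one_sub_self, ← hq] at h2
    rcases hpp.dvd_or_dvd h2 with h | h
    · rcases hpp.dvd_or_dvd h with h | h
      · refine Dvd.dvd.mul_right ((hpp.dvd_or_dvd h).resolve_left ?_) _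
        exact emultiplicity_eq_zero.1 (emultiplicity_two_of_three_lt hp3)
      · exact (h.trans (chebS_dvd_chebS X ⟨q * (-2 * v), by ring⟩)).mul_left _
    · exact (h.trans (chebS_dvd_chebS X ⟨(q + 1) * (-2 * v), by ring⟩)).mul_left _
  rw [e, chebT_two_mul_add_one_sub_self]
  exact (hd.mul_left (2 * chebS (q * (q + 1) * (-2 * v) + 1) X)).trans (dvd_of_eq (by ring))

end LocalModel

/-! ### Cycles of functional graphs with periodic points -/

section PermutationGraph

open Function

variable {V W : Type*} {f : V → V}

/-- The functional graph of a self-map. -/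
def functionalGraph (f : V → V) : Digraph V where
  Adj X Y := Y = f X

theorem eqvGen_adj_functionalGraph_iff (hf : ∀ X, X ∈ periodicPts f) {X Y : V} :
    Relation.EqvGen (functionalGraph f).Adj X Y ↔ ∃ i, f^[i] X = Y := by
  constructor
  · intro h
    induction h with
    | rel X Y h => exact ⟨1, h.symm⟩
    | refl X => exact ⟨0, rfl⟩
    | symm X Y _ ih =>
      obtain ⟨i, rfl⟩ := ih
      obtain ⟨m, hm, hX⟩ := mem_periodicPts.1 (hf X)
      -- After i steps, another i * m - i steps complete i periods of length m.
      refine ⟨i * m - i, ?_⟩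
      rw [← iterate_add_apply, Nat.sub_add_cancel (Nat.le_mul_of_pos_right i hm)]
      exact hX.const_mul i
    | trans X Y Z _ _ ih1 ih2 =>
      obtain ⟨i, rfl⟩ := ih1
      obtain ⟨j, rfl⟩ := ih2
      exact ⟨j + i, iterate_add_apply f j i X⟩
  · rintro ⟨i, rfl⟩
    induction i with
    | zero => exact Relation.EqvGen.refl _
    | succ i ih =>
      refine ih.trans _ _ _ (Relation.EqvGen.rel _ _ ?_)
      exact iterate_succ_apply' f i X

theorem setOf_eqvGen_adj_functionalGraph (hf : ∀ X, X ∈ periodicPts f) (X : V) :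
    {Y | Relation.EqvGen (functionalGraph f).Adj X Y} = Set.range fun i ↦ f^[i] X := by
  ext Y
  exact eqvGen_adj_functionalGraph_iff hf

theorem isDirectedCycle_range_iterate {X : V} (hX : X ∈ periodicPts f) :
    (functionalGraph f).IsDirectedCycle (Set.range fun i ↦ f^[i] X) (minimalPeriod f X) := by
  have hpos := minimalPeriod_pos_of_mem_periodicPts hX
  have : NeZero (minimalPeriod f X) := ⟨hpos.ne'⟩
  have hinj : Injective fun i : ZMod (minimalPeriod f X) ↦ f^[i.val] X := fun i j h ↦
    ZMod.val_injective _ (iterate_injOn_Iio_minimalPeriod (ZMod.val_lt i) (ZMod.val_lt j) h)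
  have hadd (i : ZMod (minimalPeriod f X)) : f^[(i + 1).val] X = f (f^[i.val] X) := by
    rw [← iterate_succ_apply' f, ← iterate_mod_minimalPeriod_eq (n := i.val.succ)]
    congr 2
    rw [← ZMod.val_natCast, Nat.succ_eq_add_one]
    simp
  refine ⟨hpos, fun i ↦ f^[i.val] X, hinj, ?_, fun i j ↦ ?_⟩
  · ext Y
    constructor
    · rintro ⟨i, rfl⟩
      exact ⟨_, rfl⟩
    · rintro ⟨i, rfl⟩
      refine ⟨(i : ZMod _), ?_⟩
      simp only [ZMod.val_natCast]
      exact iterate_mod_minimalPeriod_eq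
  · change f^[j.val] X = f (f^[i.val] X) ↔ _
    rw [← hadd]
    exact hinj.eq_iff

theorem Digraph.IsDirectedCycle.ncard_eq {D : Digraph V} {C : Set V} {L : ℕ}
    (h : D.IsDirectedCycle C L) : C.ncard = L := by
  obtain ⟨-, v, hv, rfl, -⟩ := h
  rw [← Set.image_univ, Set.ncard_image_of_injective _ hv, Set.ncard_univ, Nat.card_zmod]

theorem iterate_mem_iff {S : Set V} (hS : ∀ X, f X ∈ S ↔ X ∈ S) (i : ℕ) (X : V) :
    f^[i] X ∈ S ↔ X ∈ S := by
  induction i with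
  | zero => rfl
  | succ i ih => rw [iterate_succ_apply', hS, ih]

theorem sUnion_weakComponents_functionalGraph {S : Set V} (hf : ∀ X, X ∈ periodicPts f)
    (hS : ∀ X, f X ∈ S ↔ X ∈ S) :
    ⋃₀ {C ∈ (functionalGraph f).weakComponents | (C ∩ S).Nonempty} = S := by
  ext Y
  constructor
  · rintro ⟨C, ⟨⟨X, rfl⟩, Z, hZ, hZS⟩, hY⟩
    rw [setOf_eqvGen_adj_functionalGraph hf] at hZ hY
    obtain ⟨i, rfl⟩ := hZ
    obtain ⟨j, rfl⟩ := hY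
    exact (iterate_mem_iff hS j X).2 ((iterate_mem_iff hS i X).1 hZS)
  · intro hY
    exact ⟨_, ⟨⟨Y, rfl⟩, Y, Relation.EqvGen.refl _, hY⟩, Relation.EqvGen.refl _⟩

/-- If every point is periodic, then the components of the functional graph that meet an invariant
set are cycles, and their lengths are determined by the number of points of each period. -/
theorem composedOfCycles_functionalGraph [Finite V] {S : Set V} (hf : ∀ X, X ∈ periodicPts f)
    (hS : ∀ X, f X ∈ S ↔ X ∈ S) {M : Multiset ℕ} (h0 : 0 ∉ M)
    (hM : ∀ L, L * M.count L = {X ∈ S | minimalPeriod f X = L}.ncard) :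
    (functionalGraph f).ComposedOfCycles
      {C ∈ (functionalGraph f).weakComponents | (C ∩ S).Nonempty} M := by
  classical
  have hcomp : ∀ C ∈ (functionalGraph f).weakComponents,
      ∃ X, C = Set.range fun i ↦ f^[i] X := by
    rintro C ⟨X, rfl⟩
    exact ⟨X, setOf_eqvGen_adj_functionalGraph hf X⟩
  refine ⟨fun C hC ↦ ?_, fun L ↦ ?_⟩
  · obtain ⟨X, rfl⟩ := hcomp C hC.1
    exact ⟨_, isDirectedCycle_range_iterate (hf X)⟩
  -- At L = 0 the hypothesis `hM` says nothing about the count; `h0` settles this case.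
  rcases Nat.eq_zero_or_pos L with rfl | hL
  · rw [Multiset.count_eq_zero_of_notMem h0, Set.ncard_eq_zero]
    ext C
    simp only [Set.mem_ofPred_eq, Set.mem_empty_iff_false, iff_false, not_and]
    exact fun _ h ↦ h.1.ne' rfl
  refine Nat.eq_of_mul_eq_mul_left hL ?_
  rw [hM]
  set T := {C ∈ {C ∈ (functionalGraph f).weakComponents | (C ∩ S).Nonempty} |
    (functionalGraph f).IsDirectedCycle C L} with hT
  have hmaps : ∀ X ∈ {X ∈ S | minimalPeriod f X = L}.toFinite.toFinset,
      (Set.range fun i ↦ f^[i] X) ∈ T.toFinite.toFinset := by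
    intro X hX
    rw [Set.Finite.mem_toFinset] at hX ⊢
    refine ⟨⟨⟨X, (setOf_eqvGen_adj_functionalGraph hf X).symm⟩, X, ⟨0, rfl⟩, hX.1⟩, ?_⟩
    rw [← hX.2]
    exact isDirectedCycle_range_iterate (hf X)
  -- Sort the points of period L by their orbits: each fibre is a whole cycle of L points.
  rw [Set.ncard_eq_toFinset_card _, Set.ncard_eq_toFinset_card _,
    Finset.card_eq_sum_card_fiberwise hmaps, mul_comm, ← smul_eq_mul, ← Finset.sum_const]
  refine (Finset.sum_congr rfl fun C hC ↦ ?_).symm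
  rw [Set.Finite.mem_toFinset] at hC
  obtain ⟨⟨hC, hCS⟩, hCL⟩ := hC
  have hcard := hCL.ncard_eq
  rw [Set.ncard_eq_toFinset_card _] at hcard
  refine Eq.trans ?_ hcard
  congr 1
  ext Y
  simp only [Finset.mem_filter, Set.Finite.mem_toFinset, Set.mem_ofPred_eq]
  obtain ⟨X, rfl⟩ := hcomp C hC
  rw [iff_comm]
  constructor
  · rintro ⟨i, rfl⟩
    obtain ⟨Z, ⟨j, rfl⟩, hZ⟩ := hCS
    refine ⟨⟨?_, ?_⟩, ?_⟩
    · exact (iterate_mem_iff hS i X).2 ((iterate_mem_iff hS j X).1 hZ)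
    · rw [minimalPeriod_apply_iterate (hf X), ← hCL.ncard_eq,
        (isDirectedCycle_range_iterate (hf X)).ncard_eq]
    · rw [← setOf_eqvGen_adj_functionalGraph hf, ← setOf_eqvGen_adj_functionalGraph hf]
      have h := (eqvGen_adj_functionalGraph_iff hf (X := X)).2 ⟨i, rfl⟩
      ext Z
      exact ⟨fun h' ↦ h.trans _ _ _ h', fun h' ↦ (h.symm _ _).trans _ _ _ h'⟩
  · rintro ⟨-, h⟩
    rw [← h]
    exact ⟨0, rfl⟩

/-- Points of given period over a cycle of the base are equidistributed among the fibres. -/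
theorem ncard_minimalPeriod_over_cycle [Finite V] {g : W → W} {π : V → W} (hf : Injective f)
    (hg : Injective g) (hπ : Semiconj π f g) (x : W) (L : ℕ) :
    {X | (∃ j < minimalPeriod g x, π X = g^[j] x) ∧ minimalPeriod f X = L}.ncard =
      minimalPeriod g x * {X | π X = x ∧ minimalPeriod f X = L}.ncard := by
  have hper (X : V) : X ∈ periodicPts f := hf.mem_periodicPts X
  have himage : {X | (∃ j < minimalPeriod g x, π X = g^[j] x) ∧ minimalPeriod f X = L} =
      (fun q : ℕ × V ↦ f^[q.1] q.2) ''
        (Set.Iio (minimalPeriod g x) ×ˢ {X | π X = x ∧ minimalPeriod f X = L}) := by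
    ext Y
    constructor
    · rintro ⟨⟨j, hj, hY⟩, hL⟩
      obtain ⟨X, rfl⟩ := (Finite.surjective_of_injective (hf.iterate j)) Y
      refine ⟨(j, X), ⟨hj, ?_, ?_⟩, rfl⟩
      · rw [(hπ.iterate_right j).eq] at hY
        exact hg.iterate j hY
      · rwa [minimalPeriod_apply_iterate (hper X)] at hL
    · rintro ⟨⟨j, X⟩, ⟨hj, hX, hL⟩, rfl⟩
      refine ⟨⟨j, hj, ?_⟩, ?_⟩
      · simp only [(hπ.iterate_right j).eq, hX]
      · simp only [minimalPeriod_apply_iterate (hper X), hL]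
  rw [himage, Set.InjOn.ncard_image, Set.ncard_prod]
  · simp
  · rintro ⟨j, X⟩ ⟨hj, hX, -⟩ ⟨j', X'⟩ ⟨hj', hX', -⟩ h
    simp only at h hj hj' hX hX'
    have h1 := congrArg π h
    rw [(hπ.iterate_right j).eq, (hπ.iterate_right j').eq, hX, hX'] at h1
    have h2 : j = j' := iterate_injOn_Iio_minimalPeriod hj hj' h1
    subst h2
    rw [hf.iterate j h]

end PermutationGraph

/-! ### Orders modulo prime powers and counts of points -/

section Counting

variable {p : ℕ} {x : ℤ} {D : Polynomial ℤ} {A : ℤ}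

theorem pow_ne_one_of_one_lt_natAbs {A : ℤ} (hA : 1 < A.natAbs) {r : ℕ} (hr : r ≠ 0) :
    A ^ r ≠ 1 := by
  intro h
  have := congrArg Int.natAbs h
  rw [Int.natAbs_pow] at this
  exact (Nat.one_lt_pow hr hA).ne' this

theorem intCast_pow_eq_one_iff (p : ℕ) (A : ℤ) (r : ℕ) :
    (A : ZMod p) ^ r = 1 ↔ (p : ℤ) ∣ A ^ r - 1 := by
  rw [← ZMod.intCast_zmod_eq_zero_iff_dvd]
  push_cast
  exact sub_eq_zero.symm

/-- The order of `A` modulo `p ^ i`, in terms of its order modulo `p`. -/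
theorem pow_dvd_pow_sub_one_iff (hp : p.Prime) (hp2 : p ≠ 2) {l w i : ℕ}
    (hl : l = orderOf (A : ZMod p)) (hw : emultiplicity (p : ℤ) (A ^ l - 1) = w) (hi : i ≠ 0)
    (hpA : ¬(p : ℤ) ∣ A) (hl0 : 0 < l) (r : ℕ) :
    (p : ℤ) ^ i ∣ A ^ r - 1 ↔ l * p ^ (i - w) ∣ r := by
  by_cases hlr : l ∣ r
  · obtain ⟨s, rfl⟩ := hlr
    have h1 : (p : ℤ) ∣ A ^ l - 1 := by
      rw [← intCast_pow_eq_one_iff, hl, pow_orderOf_eq_one]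
    -- Lifting the exponent: v(A^(ls) - 1) = w + v(s). The truncated `i - w` covers i ≤ w.
    have h2 := Int.emultiplicity_pow_sub_pow hp (hp.odd_of_ne_two hp2) (x := A ^ l) (y := 1) h1
      (fun h ↦ hpA ((Nat.prime_iff_prime_int.1 hp).dvd_of_dvd_pow h)) s
    rw [one_pow, ← pow_mul, hw] at h2
    rw [pow_dvd_iff_le_emultiplicity, h2, Nat.mul_dvd_mul_iff_left hl0,
      pow_dvd_iff_le_emultiplicity]
    by_cases ht : emultiplicity p s = ⊤
    · simp [ht]
    · lift emultiplicity p s to ℕ using ht with m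
      norm_cast
      omega
  · refine iff_of_false (fun h ↦ hlr ?_) (fun h ↦ hlr ((dvd_mul_right _ _).trans h))
    rw [hl, orderOf_dvd_iff_pow_eq_one, intCast_pow_eq_one_iff]
    exact (dvd_pow_self _ hi).trans h

theorem intCast_dvd_val_iff {m d : ℕ} [NeZero m] (hd : d ∣ m) (z : ℤ) :
    (d : ℤ) ∣ ((z : ZMod m).val : ℤ) ↔ (d : ℤ) ∣ z := by
  rw [ZMod.val_intCast]
  rw [Int.dvd_iff_emod_eq_zero, Int.dvd_iff_emod_eq_zero,
    Int.emod_emod_of_dvd z (Int.natCast_dvd_natCast.2 hd)]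

theorem ncard_dvd_val {a b : ℕ} (ha : 0 < a) (hb : 0 < b) :
    {Y : ZMod (a * b) | (a : ℤ) ∣ (Y.val : ℤ)}.ncard = b := by
  have : NeZero (a * b) := ⟨by positivity⟩
  have h : {Y : ZMod (a * b) | (a : ℤ) ∣ (Y.val : ℤ)} =
      (fun i : ℕ ↦ ((a * i : ℕ) : ZMod (a * b))) '' Set.Iio b := by
    ext Y
    constructor
    · intro hY
      obtain ⟨i, hi⟩ : a ∣ Y.val := by exact_mod_cast hY
      refine ⟨i, ?_, ?_⟩
      · have := ZMod.val_lt Y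
        rw [hi] at this
        exact lt_of_mul_lt_mul_left this ha.le
      · simp only [← hi, ZMod.natCast_val, ZMod.cast_id', id]
    · rintro ⟨i, hi, rfl⟩
      have := (intCast_dvd_val_iff (m := a * b) (dvd_mul_right a b) ((a * i : ℕ) : ℤ)).2
        (by push_cast; exact dvd_mul_right _ _)
      simpa using this
  rw [h, Set.InjOn.ncard_image]
  · simp
  · intro i hi j hj hij
    simp only at hij
    rw [ZMod.natCast_eq_natCast_iff'] at hij
    rw [Nat.mod_eq_of_lt (Nat.mul_lt_mul_of_pos_left hi ha),
      Nat.mod_eq_of_lt (Nat.mul_lt_mul_of_pos_left hj ha)] at hij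
    exact Nat.eq_of_mul_eq_mul_left ha hij

theorem ncard_pow_dvd_val (hp : p.Prime) {a k : ℕ} (h : a ≤ k) :
    {Y : ZMod (p ^ k) | (p : ℤ) ^ a ∣ (Y.val : ℤ)}.ncard = p ^ (k - a) := by
  obtain ⟨b, rfl⟩ := Nat.exists_eq_add_of_le h
  rw [Nat.add_sub_cancel_left, pow_add]
  exact_mod_cast ncard_dvd_val (pow_pos hp.pos a) (pow_pos hp.pos b)

theorem ncard_dvd_val_sub (hp : p.Prime) {k : ℕ} (hk : 1 ≤ k) (x : ℤ) :
    {X : ZMod (p ^ k) | (p : ℤ) ∣ (X.val : ℤ) - x}.ncard = p ^ (k - 1) := by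
  have : NeZero (p ^ k) := ⟨(pow_pos hp.pos k).ne'⟩
  have hpk : p ∣ p ^ k := dvd_pow_self p (by omega)
  rw [← ncard_pow_dvd_val hp hk, pow_one]
  have h : {X : ZMod (p ^ k) | (p : ℤ) ∣ (X.val : ℤ) - x} =
      (fun Y ↦ Y + (x : ZMod (p ^ k))) '' {Y : ZMod (p ^ k) | (p : ℤ) ∣ (Y.val : ℤ)} := by
    ext X
    rw [Set.image_add_right, Set.mem_preimage, Set.mem_ofPred_eq, Set.mem_ofPred_eq,
      ← intCast_dvd_val_iff hpk]
    push_cast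
    simp [sub_eq_add_neg]
  rw [h, Set.ncard_image_of_injective _ (add_left_injective _)]

/-- A polynomial with a simple root modulo `p` is injective modulo `p ^ k` near this root. -/
theorem pow_dvd_sub_of_pow_dvd_eval_sub (hp : p.Prime) (hD : ¬(p : ℤ) ∣ D.derivative.eval x)
    {a b : ℤ} (ha : (p : ℤ) ∣ a - x) (hb : (p : ℤ) ∣ b - x) {k : ℕ}
    (h : (p : ℤ) ^ k ∣ D.eval a - D.eval b) : (p : ℤ) ^ k ∣ a - b := by
  have hpp := Nat.prime_iff_prime_int.1 hp
  obtain ⟨c, hc⟩ := D.binomExpansion b (a - b)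
  rw [add_sub_cancel] at hc
  have hab : (p : ℤ) ∣ a - b := by simpa using dvd_sub ha hb
  have h1 : D.eval a - D.eval b = (D.derivative.eval b + c * (a - b)) * (a - b) := by
    rw [hc]; ring
  rw [h1] at h
  refine IsCoprime.dvd_of_dvd_mul_left (IsCoprime.pow_left (hpp.coprime_iff_not_dvd.2 ?_)) h
  intro h2
  have h3 := (dvd_add_left (hab.mul_left c)).1 h2
  have h4 := hb.trans (Polynomial.sub_dvd_eval_sub b x D.derivative)
  exact hD ((dvd_iff_dvd_of_dvd_sub h4).1 h3)

/-- D is injective on the class, whose size equals that of its target, the multiples of p; hence it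
is onto, and the count transfers to multiples of p^a. -/
theorem ncard_pow_dvd_eval (hp : p.Prime) (hD0 : (p : ℤ) ∣ D.eval x)
    (hD : ¬(p : ℤ) ∣ D.derivative.eval x) {k a : ℕ} (ha : 1 ≤ a) (hak : a ≤ k) :
    {X : ZMod (p ^ k) | (p : ℤ) ∣ (X.val : ℤ) - x ∧ (p : ℤ) ^ a ∣ D.eval (X.val : ℤ)}.ncard =
      p ^ (k - a) := by
  have : NeZero (p ^ k) := ⟨(pow_pos hp.pos k).ne'⟩
  have hpk : p ∣ p ^ k := dvd_pow_self p (by omega)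
  set K := {X : ZMod (p ^ k) | (p : ℤ) ∣ (X.val : ℤ) - x} with hK
  set δ : ZMod (p ^ k) → ZMod (p ^ k) := fun X ↦ ((D.eval (X.val : ℤ) : ℤ) : ZMod (p ^ k)) with hδ
  have hδv (X) {d : ℕ} (hd : d ≤ k) :
      (p : ℤ) ^ d ∣ ((δ X).val : ℤ) ↔ (p : ℤ) ^ d ∣ D.eval (X.val : ℤ) := by
    exact_mod_cast intCast_dvd_val_iff (pow_dvd_pow p hd) (D.eval (X.val : ℤ))
  have hinj : Set.InjOn δ K := by
    intro X hX Y hY h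
    have h1 : (p : ℤ) ^ k ∣ D.eval (X.val : ℤ) - D.eval (Y.val : ℤ) := by
      have h2 := (ZMod.intCast_eq_intCast_iff_dvd_sub _ _ _).1 h.symm
      exact_mod_cast h2
    have h3 := pow_dvd_sub_of_pow_dvd_eval_sub hp hD hX hY h1
    have h4 : (((Y.val : ℤ) : ℤ) : ZMod (p ^ k)) = ((X.val : ℤ) : ZMod (p ^ k)) :=
      (ZMod.intCast_eq_intCast_iff_dvd_sub _ _ _).2 (by exact_mod_cast h3)
    simpa using h4.symm
  have himage : δ '' K = {Y | (p : ℤ) ^ 1 ∣ (Y.val : ℤ)} := by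
    refine Set.eq_of_subset_of_ncard_le ?_ ?_
    · rintro _ ⟨X, hX, rfl⟩
      refine (hδv X (ha.trans hak)).2 ?_
      rw [pow_one]
      exact (dvd_iff_dvd_of_dvd_sub (hX.trans (Polynomial.sub_dvd_eval_sub _ _ D))).2 hD0
    · rw [ncard_pow_dvd_val hp (ha.trans hak), hinj.ncard_image,
        ncard_dvd_val_sub hp (ha.trans hak)]
  rw [← ncard_pow_dvd_val hp hak, ← (hinj.mono fun X hX ↦ hX.1).ncard_image]
  congr 1
  ext Y
  constructor
  · rintro ⟨X, hX, rfl⟩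
    exact (hδv X hak).2 hX.2
  · intro hY
    have h1 : Y ∈ δ '' K := by
      rw [himage]
      exact (pow_dvd_pow _ ha).trans hY
    obtain ⟨X, hX, rfl⟩ := h1
    exact ⟨X, ⟨hX, (hδv X hak).1 hY⟩, rfl⟩

theorem sum_range_pred_mul_pow (hp : 1 ≤ p) (a m : ℕ) :
    ∑ i ∈ Finset.range m, (p - 1) * p ^ (a + i) = p ^ (a + m) - p ^ a := by
  induction m with
  | zero => simp
  | succ m ih =>
    rw [Finset.sum_range_succ, ih, Nat.sub_one_mul, ← add_assoc, pow_succ']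
    have h1 : p ^ a ≤ p ^ (a + m) := Nat.pow_le_pow_right hp (by omega)
    have h2 : p ^ (a + m) ≤ p * p ^ (a + m) := Nat.le_mul_of_pos_left _ hp
    omega

theorem dvd_pow_sub_one_of_dvd_sub_one {l : ℕ} (hl : l ∣ p - 1) (m : ℕ) : l ∣ p ^ m - 1 :=
  hl.trans (by simpa using Nat.sub_dvd_pow_sub_pow p 1 m)

theorem mul_count_replicate (L a c : ℕ) :
    L * (Multiset.replicate c a).count L = if L = a then a * c else 0 := by
  rw [Multiset.count_replicate]
  by_cases h : L = a
  · simp [h]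
  · simp [h, Ne.symm h]

/-- The right side counts points by the level i + 1 = k - v(D(X)). For k ≤ w + 1 each exponent
truncates to 0, and the levels telescope. -/
theorem mul_count_cycle_lengths_of_le (hp : p.Prime) {N l w k : ℕ} (hl : l ∣ p - 1)
    (hk : k ≤ w + 1) (L : ℕ) :
    L * (Multiset.replicate ((p ^ (k - 1) - 1) / l) (N * l) + {N}).count L =
      N * ((if L = N then 1 else 0) + ∑ i ∈ Finset.range (k - 1),
        if L = N * (l * p ^ (i + 1 - w)) then (p - 1) * p ^ i else 0) := by
  have h : ∑ i ∈ Finset.range (k - 1), (if L = N * (l * p ^ (i + 1 - w)) then (p - 1) * p ^ i else 0) =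
      if L = N * l then p ^ (k - 1) - 1 else 0 := by
    have h1 := sum_range_pred_mul_pow hp.one_le 0 (k - 1)
    simp only [zero_add, pow_zero] at h1
    rw [← h1]
    split_ifs with hL
    · refine Finset.sum_congr rfl fun i hi ↦ ?_
      have := Finset.mem_range.1 hi
      rw [show i + 1 - w = 0 by omega, pow_zero, mul_one, if_pos hL]
    · refine Finset.sum_eq_zero fun i hi ↦ ?_
      have := Finset.mem_range.1 hi
      rw [show i + 1 - w = 0 by omega, pow_zero, mul_one, if_neg hL]
  rw [h, Multiset.count_add, mul_add, mul_count_replicate, mul_assoc,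
    Nat.mul_div_cancel' (dvd_pow_sub_one_of_dvd_sub_one hl _), ← Multiset.replicate_one,
    mul_count_replicate, mul_add]
  split_ifs <;> simp [add_comm]

theorem mul_count_cycle_lengths_of_lt (hp : p.Prime) {N l w k : ℕ} (hl : l ∣ p - 1)
    (hw : 1 ≤ w) (hk : w + 1 < k) (L : ℕ) :
    L * ((∑ i ∈ Finset.Icc 1 (k - w - 1),
        Multiset.replicate ((p - 1) * p ^ (w - 1) / l) (N * l * p ^ i))
        + Multiset.replicate ((p ^ w - 1) / l) (N * l) + {N}).count L =
      N * ((if L = N then 1 else 0) + ∑ i ∈ Finset.range (k - 1),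
        if L = N * (l * p ^ (i + 1 - w)) then (p - 1) * p ^ i else 0) := by
  -- The levels i < w are exactly the case k = w + 1; only the later ones give longer cycles.
  have h0 := mul_count_cycle_lengths_of_le hp (N := N) (w := w) (k := w + 1) hl le_rfl L
  rw [add_tsub_cancel_right] at h0
  obtain ⟨m, rfl⟩ := Nat.exists_eq_add_of_lt hk
  rw [show w + 1 + m + 1 - 1 = w + (m + 1) by omega, show w + 1 + m + 1 - w - 1 = m + 1 by omega,
    Finset.sum_range_add, ← add_assoc, mul_add, ← h0, add_assoc, Multiset.count_add, mul_add,
    add_comm, Multiset.count_sum', Finset.mul_sum, Finset.mul_sum]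
  congr 1
  rw [← Finset.Ico_add_one_right_eq_Icc, Finset.sum_Ico_eq_sum_range]
  refine Finset.sum_congr rfl fun i _ ↦ ?_
  rw [mul_count_replicate, show w + i + 1 - w = 1 + i by omega, ← mul_assoc N]
  split_ifs
  · obtain ⟨c, hc⟩ := hl.mul_right (p ^ (w - 1))
    obtain ⟨v, rfl⟩ := Nat.exists_eq_add_of_le hw
    rw [Nat.add_sub_cancel_left] at hc ⊢
    rcases Nat.eq_zero_or_pos l with rfl | hl0
    · have := hp.two_le
      rw [zero_dvd_iff] at hl
      omega
    · rw [hc, Nat.mul_div_cancel_left _ hl0]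
      calc N * l * p ^ (1 + i) * c = N * (l * c) * p ^ (1 + i) := by ring
        _ = _ := by rw [← hc]; ring
  · simp

end Counting

/-! ### Periods of the Chebyshev map modulo p^k -/

section ChebyshevMap

open Function

variable {p n k : ℕ}

theorem chebyshevMap_intCast (n m : ℕ) (z : ℤ) : chebyshevMap n m z = (chebT n z : ZMod m) := by
  have h := Polynomial.Chebyshev.algebraMap_eval_T (R := ℤ) (R' := ZMod m) z n
  simp only [algebraMap_int_eq, eq_intCast] at h
  rw [chebyshevMap, chebT, h]

theorem iterate_chebyshevMap_intCast (n m t : ℕ) (z : ℤ) :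
    (chebyshevMap n m)^[t] z = (chebT ((n : ℤ) ^ t) z : ZMod m) := by
  induction t with
  | zero => simp
  | succ t ih => rw [iterate_succ_apply', ih, chebyshevMap_intCast, pow_succ', chebT_mul]

theorem iterate_chebyshevMap_eq_self_iff (n m t : ℕ) (z : ℤ) :
    (chebyshevMap n m)^[t] z = z ↔ (m : ℤ) ∣ chebT ((n : ℤ) ^ t) z - z := by
  rw [iterate_chebyshevMap_intCast, eq_comm, ZMod.intCast_eq_intCast_iff_dvd_sub]

theorem semiconj_castHom_chebyshevMap {m m' : ℕ} (h : m ∣ m') (n : ℕ) :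
    Semiconj (ZMod.castHom h (ZMod m)) (chebyshevMap n m') (chebyshevMap n m) := by
  intro X
  obtain ⟨z, rfl⟩ := ZMod.intCast_surjective X
  rw [chebyshevMap_intCast, map_intCast, map_intCast, chebyshevMap_intCast]

theorem chebyshevMap_injective (hp : p.Prime) (hp3 : 3 < p) (hn : n.Coprime (p ^ 2 - 1)) :
    Injective (chebyshevMap n p) := by
  obtain ⟨m, hm⟩ := exists_dvd_chebT_chebT_sub_self hp hp3 hn
  intro X Y h
  obtain ⟨a, rfl⟩ := ZMod.intCast_surjective X
  obtain ⟨b, rfl⟩ := ZMod.intCast_surjective Y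
  rw [chebyshevMap_intCast, chebyshevMap_intCast, ZMod.intCast_eq_intCast_iff] at h
  rw [ZMod.intCast_eq_intCast_iff]
  have h1 (z : ℤ) : chebT m (chebT n z) ≡ z [ZMOD p] := (Int.modEq_iff_dvd.2 (hm z)).symm
  exact (h1 a).symm.trans ((chebT_modEq h m).trans (h1 b))

theorem odd_of_coprime_sq_sub_one (hp : p.Prime) (hp3 : 3 < p) (hn : n.Coprime (p ^ 2 - 1)) :
    Odd n := by
  have h2 : 2 ∣ p ^ 2 - 1 := by
    have h := (hp.odd_of_ne_two (by omega)).pow (n := 2)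
    obtain ⟨q, hq⟩ := h
    exact ⟨q, by omega⟩
  exact (Nat.coprime_two_right (n := n)).1 (hn.coprime_dvd_right h2)

theorem exists_isLocalModel_of_isPeriodicPt (hp : p.Prime) (hp3 : 3 < p) (hn : 1 < n)
    (hnp : n.Coprime p) (hnp2 : n.Coprime (p ^ 2 - 1)) {x : ℤ} {N : ℕ} (hN : 0 < N)
    (hx : IsPeriodicPt (chebyshevMap n p) N (x : ZMod p)) :
    ∃ D A, IsLocalModel p (n ^ N) x D A := by
  refine exists_isLocalModel hp hp3 (odd_of_coprime_sq_sub_one hp hp3 hnp2).pow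
    (Nat.one_lt_pow hN.ne' hn) ?_ ?_
  · intro h
    exact (hp.coprime_iff_not_dvd.1 hnp.symm) (hp.dvd_of_dvd_pow h)
  · have := (iterate_chebyshevMap_eq_self_iff n p N x).1 hx
    exact_mod_cast this

theorem IsLocalModel.iterate_eq_self_iff {N : ℕ} {x : ℤ} {D : Polynomial ℤ} {A : ℤ}
    (h : IsLocalModel p (n ^ N) x D A) {z : ℤ} (hz : (p : ℤ) ∣ z - x) (k r : ℕ) :
    (chebyshevMap n (p ^ k))^[N * r] (z : ZMod (p ^ k)) = z ↔
      (k : ℕ∞) ≤ emultiplicity (p : ℤ) (A ^ r - 1) + emultiplicity (p : ℤ) (D.eval z) := by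
  have h1 := h.emultiplicity_eq r z hz
  push_cast at h1
  rw [iterate_chebyshevMap_eq_self_iff, ← h1, Nat.cast_pow, pow_dvd_iff_le_emultiplicity, pow_mul]

theorem mem_periodicPts_chebyshevMap (hp : p.Prime) (hp3 : 3 < p) (hn : 1 < n)
    (hnp : n.Coprime p) (hnp2 : n.Coprime (p ^ 2 - 1)) (X : ZMod (p ^ k)) :
    X ∈ periodicPts (chebyshevMap n (p ^ k)) := by
  have : Fact p.Prime := ⟨hp⟩
  obtain ⟨z, rfl⟩ := ZMod.intCast_surjective X
  obtain ⟨N, hN, hz⟩ := mem_periodicPts.1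
    ((chebyshevMap_injective hp hp3 hnp2).mem_periodicPts (z : ZMod p))
  obtain ⟨D, A, h⟩ := exists_isLocalModel_of_isPeriodicPt hp hp3 hn hnp hnp2 hN hz
  have hA : IsCoprime A ((p ^ k : ℕ) : ℤ) := by
    push_cast
    exact ((Nat.prime_iff_prime_int.1 hp).coprime_iff_not_dvd.2 h.not_dvd).symm.pow_right
  -- By Euler's theorem A^φ(p^k) ≡ 1 modulo p^k, so the term v(A^r - 1) alone suffices.
  refine mem_periodicPts.2 ⟨N * (p ^ k).totient,
    Nat.mul_pos hN (Nat.totient_pos.2 (pow_pos hp.pos k)), ?_⟩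
  refine (h.iterate_eq_self_iff (by simp) k _).2 (le_add_right ?_)
  refine le_emultiplicity_of_pow_dvd ?_
  have h1 := ZMod.pow_totient ((ZMod.coe_int_isUnit_iff_isCoprime A (p ^ k)).2 hA.symm).unit
  have h2 := congrArg Units.val h1
  simp only [Units.val_pow_eq_pow_val, IsUnit.unit_spec, Units.val_one] at h2
  rw [intCast_pow_eq_one_iff] at h2
  exact_mod_cast h2

theorem injective_of_forall_mem_periodicPts {V : Type*} {f : V → V}
    (h : ∀ X, X ∈ periodicPts f) : Injective f := by
  intro X Y hXY
  obtain ⟨a, ha, hX⟩ := mem_periodicPts.1 (h X)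
  obtain ⟨b, hb, hY⟩ := mem_periodicPts.1 (h Y)
  exact hX.eq_of_apply_eq hY ha hb hXY

theorem minimalPeriod_eq_mul_of_semiconj {V W : Type*} {f : V → V} {g : W → W} {π : V → W}
    (hπ : Semiconj π f g) {X : V} {d : ℕ}
    (h : ∀ r, f^[minimalPeriod g (π X) * r] X = X ↔ d ∣ r) :
    minimalPeriod f X = minimalPeriod g (π X) * d := by
  refine Nat.dvd_antisymm (IsPeriodicPt.minimalPeriod_dvd ((h d).2 dvd_rfl)) ?_
  have h1 : IsPeriodicPt g (minimalPeriod f X) (π X) := (isPeriodicPt_minimalPeriod f X).map hπ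
  obtain ⟨r, hr⟩ := h1.minimalPeriod_dvd
  rw [hr]
  refine mul_dvd_mul_left _ ((h r).1 ?_)
  rw [← hr]
  exact iterate_minimalPeriod

/-- The number of points of given period in a residue class modulo `p`. -/
theorem IsLocalModel.ncard_minimalPeriod_eq (hp : p.Prime) (hp2 : p ≠ 2) {x : ℤ}
    {D : Polynomial ℤ} {A : ℤ}
    (h : IsLocalModel p (n ^ minimalPeriod (chebyshevMap n p) (x : ZMod p)) x D A)
    (hk : 1 ≤ k) {l w : ℕ} (hl : l = orderOf (A : ZMod p)) (hl0 : 0 < l)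
    (hw : emultiplicity (p : ℤ) (A ^ l - 1) = w) (L : ℕ) :
    {X : ZMod (p ^ k) | (p : ℤ) ∣ (X.val : ℤ) - x ∧
        minimalPeriod (chebyshevMap n (p ^ k)) X = L}.ncard =
      (if L = minimalPeriod (chebyshevMap n p) (x : ZMod p) then 1 else 0) +
        ∑ i ∈ Finset.range (k - 1),
          if L = minimalPeriod (chebyshevMap n p) (x : ZMod p) * (l * p ^ (i + 1 - w))
          then (p - 1) * p ^ i else 0 := by
  have : NeZero (p ^ k) := ⟨(pow_pos hp.pos k).ne'⟩
  have hpk : p ∣ p ^ k := dvd_pow_self p (by omega)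
  set N := minimalPeriod (chebyshevMap n p) (x : ZMod p) with hN
  set f := chebyshevMap n (p ^ k) with hf
  have hperiod (X : ZMod (p ^ k)) (hX : (p : ℤ) ∣ (X.val : ℤ) - x) {d : ℕ}
      (hd : ∀ r : ℕ, (k : ℕ∞) ≤ emultiplicity (p : ℤ) (A ^ r - 1) +
        emultiplicity (p : ℤ) (D.eval (X.val : ℤ)) ↔ d ∣ r) : minimalPeriod f X = N * d := by
    have hπX : ZMod.castHom hpk (ZMod p) X = (x : ZMod p) := by
      have h1 := (ZMod.intCast_eq_intCast_iff_dvd_sub x (X.val : ℤ) p).2 hX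
      rw [h1]
      simp
    rw [hN, ← hπX]
    refine minimalPeriod_eq_mul_of_semiconj (semiconj_castHom_chebyshevMap hpk n) fun r ↦ ?_
    rw [hπX, ← hN, ← hd r, ← h.iterate_eq_self_iff hX k r]
    simp
  -- Filter the class by v(D(X)) ≥ a: from the single point of `E k` to the whole class `E 1`, each
  -- shell has constant period.
  set E : ℕ → Set (ZMod (p ^ k)) := fun a ↦
    {X | (p : ℤ) ∣ (X.val : ℤ) - x ∧ (p : ℤ) ^ a ∣ D.eval (X.val : ℤ)} with hE
  have hEcard {a : ℕ} (ha : 1 ≤ a) (hak : a ≤ k) : (E a).ncard = p ^ (k - a) :=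
    ncard_pow_dvd_eval hp h.dvd_eval h.not_dvd_derivative ha hak
  have hE0 (X) (hX : X ∈ E k) : minimalPeriod f X = N := by
    rw [hperiod X hX.1 (d := 1), mul_one]
    intro r
    simpa using le_add_left (le_emultiplicity_of_pow_dvd hX.2)
  have hEsucc {i : ℕ} (hi : i + 1 < k) (X) (hX : X ∈ E (k - (i + 1)) \ E (k - i)) :
      minimalPeriod f X = N * (l * p ^ (i + 1 - w)) := by
    refine hperiod X hX.1.1 fun r ↦ ?_
    have hv : emultiplicity (p : ℤ) (D.eval (X.val : ℤ)) = (k - (i + 1) : ℕ) := by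
      refine emultiplicity_eq_of_dvd_of_not_dvd hX.1.2 fun h' ↦ hX.2 ⟨hX.1.1, ?_⟩
      rwa [show k - (i + 1) + 1 = k - i by omega] at h'
    rw [hv, ← pow_dvd_pow_sub_one_iff hp hp2 hl hw (Nat.succ_ne_zero i) h.not_dvd hl0,
      pow_dvd_iff_le_emultiplicity]
    by_cases ht : emultiplicity (p : ℤ) (A ^ r - 1) = ⊤
    · simp [ht]
    · lift emultiplicity (p : ℤ) (A ^ r - 1) to ℕ using ht with m
      norm_cast
      omega
  have key (i : ℕ) (hi : i < k) : {X ∈ E (k - i) | minimalPeriod f X = L}.ncard =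
      (if L = N then 1 else 0) + ∑ i ∈ Finset.range i,
        if L = N * (l * p ^ (i + 1 - w)) then (p - 1) * p ^ i else 0 := by
    induction i with
    | zero =>
      rw [Finset.sum_range_zero, add_zero, Nat.sub_zero]
      split_ifs with hL
      · rw [← pow_zero p, ← Nat.sub_self k, ← hEcard hk le_rfl]
        congr 1
        ext X
        exact ⟨fun h ↦ h.1, fun h ↦ ⟨h, hL ▸ hE0 X h⟩⟩
      · rw [Set.ncard_eq_zero]
        ext X
        refine iff_of_false (fun hX ↦ hL ?_) (Set.notMem_empty X)
        rw [← hE0 X hX.1, hX.2]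
    | succ i ih =>
      have hsub : E (k - i) ⊆ E (k - (i + 1)) := fun X hX ↦
        ⟨hX.1, (pow_dvd_pow _ (by omega)).trans hX.2⟩
      rw [Finset.sum_range_succ, ← add_assoc, ← ih (by omega)]
      have hsplit : {X ∈ E (k - (i + 1)) | minimalPeriod f X = L} =
          {X ∈ E (k - i) | minimalPeriod f X = L} ∪
            {X ∈ E (k - (i + 1)) \ E (k - i) | minimalPeriod f X = L} := by
        ext X
        by_cases hX : X ∈ E (k - i)
        · simp [hX, hsub hX]
        · simp [hX]
      rw [hsplit, Set.ncard_union_eq]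
      · congr 1
        split_ifs with hL
        · have h1 : {X ∈ E (k - (i + 1)) \ E (k - i) | minimalPeriod f X = L} =
              E (k - (i + 1)) \ E (k - i) := by
            ext X
            exact ⟨fun h ↦ h.1, fun h ↦ ⟨h, hL ▸ hEsucc hi X h⟩⟩
          rw [h1, Set.ncard_sdiff hsub, hEcard (by omega) (by omega), hEcard (by omega) (by omega),
            show k - (k - (i + 1)) = i + 1 by omega, show k - (k - i) = i by omega, pow_succ',
            Nat.sub_one_mul]
        · rw [Set.ncard_eq_zero]
          ext X
          refine iff_of_false (fun hX ↦ hL ?_) (Set.notMem_empty X)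
          rw [← hEsucc hi X hX.1, hX.2]
      · rw [Set.disjoint_left]
        exact fun X h1 h2 ↦ h2.1.2 h1.1
  rw [← key (k - 1) (by omega)]
  congr 1
  ext X
  have : k - (k - 1) = 1 := by omega
  simp only [this, hE, Set.mem_ofPred_eq, pow_one]
  refine and_congr_left fun _ ↦ ⟨fun hX ↦ ⟨hX, ?_⟩, fun hX ↦ hX.1⟩
  exact (dvd_iff_dvd_of_dvd_sub (hX.trans (Polynomial.sub_dvd_eval_sub _ _ D))).2 h.dvd_eval

theorem mem_statesOver_iff [NeZero (p ^ k)] (hk : 1 ≤ k) {x : ℕ} (X : ZMod (p ^ k)) :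
    X ∈ statesOver p n x k ↔ ∃ j < minimalPeriod (chebyshevMap n p) (x : ZMod p),
      ZMod.castHom (dvd_pow_self p (by omega : k ≠ 0)) (ZMod p) X =
        (chebyshevMap n p)^[j] (x : ZMod p) := by
  rw [statesOver, Set.mem_ofPred_eq]
  simp [periodModP]

theorem chebyshevMap_mem_statesOver_iff [NeZero (p ^ k)] (hk : 1 ≤ k) {x : ℕ}
    (hinj : Injective (chebyshevMap n p)) (hx : (x : ZMod p) ∈ periodicPts (chebyshevMap n p))
    (X : ZMod (p ^ k)) :
    chebyshevMap n (p ^ k) X ∈ statesOver p n x k ↔ X ∈ statesOver p n x k := by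
  have hpos := minimalPeriod_pos_of_mem_periodicPts hx
  have hmem (Y : ZMod p) : (∃ j < minimalPeriod (chebyshevMap n p) (x : ZMod p),
      Y = (chebyshevMap n p)^[j] x) ↔ ∃ j, Y = (chebyshevMap n p)^[j] x := by
    refine ⟨fun ⟨j, _, h⟩ ↦ ⟨j, h⟩, fun ⟨j, h⟩ ↦ ⟨_, Nat.mod_lt j hpos, ?_⟩⟩
    rw [iterate_mod_minimalPeriod_eq, h]
  rw [mem_statesOver_iff hk, mem_statesOver_iff hk, hmem, hmem,
    (semiconj_castHom_chebyshevMap _ n).eq]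
  constructor
  · rintro ⟨j, hj⟩
    -- Adding a full period makes the exponent a successor even when j = 0, so one application can
    -- be cancelled.
    rw [← iterate_add_minimalPeriod_eq, show j + minimalPeriod (chebyshevMap n p) (x : ZMod p) =
      (j + (minimalPeriod (chebyshevMap n p) (x : ZMod p) - 1)).succ by omega,
      iterate_succ_apply'] at hj
    exact ⟨_, hinj hj⟩
  · rintro ⟨j, hj⟩
    exact ⟨j.succ, by rw [iterate_succ_apply', hj]⟩

end ChebyshevMap

/-! ### The cycle structure -/

theorem proposition6 (p n k x : ℕ) (hp : p.Prime) (hp3 : 3 < p)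
    (hn : 1 < n) (hnp : Nat.Coprime n p) (hnp2 : Nat.Coprime n (p ^ 2 - 1))
    (hk : 1 ≤ k) (hx : x < p) :
    ∃ N l w : ℕ, N = periodModP p n x ∧ l = derivOrder p n x ∧
      IsGreatest (derivExponents p n x) w ∧
      1 ≤ N ∧ 1 ≤ w ∧ l ∣ p - 1 ∧
      ⋃₀ componentsOver p n x k = statesOver p n x k ∧
      (w + 1 < k →
        (chebyshevGraph n (p ^ k)).ComposedOfCycles (componentsOver p n x k)
          ((∑ i ∈ Finset.Icc 1 (k - w - 1),
              Multiset.replicate ((p - 1) * p ^ (w - 1) / l) (N * l * p ^ i))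
            + Multiset.replicate ((p ^ w - 1) / l) (N * l)
            + {N})) ∧
      (k ≤ w + 1 →
        (chebyshevGraph n (p ^ k)).ComposedOfCycles (componentsOver p n x k)
          (Multiset.replicate ((p ^ (k - 1) - 1) / l) (N * l) + {N})) := by
  have : Fact p.Prime := ⟨hp⟩
  have : NeZero (p ^ k) := ⟨(pow_pos hp.pos k).ne'⟩
  have hpk : p ∣ p ^ k := dvd_pow_self p (by omega)
  have hinj := chebyshevMap_injective hp hp3 hnp2
  have hper := mem_periodicPts_chebyshevMap (k := k) hp hp3 hn hnp hnp2
  have hxper : (x : ZMod p) ∈ Function.periodicPts (chebyshevMap n p) := hinj.mem_periodicPts _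
  have hN : 0 < periodModP p n x := Function.minimalPeriod_pos_of_mem_periodicPts hxper
  obtain ⟨D, A, h⟩ := exists_isLocalModel_of_isPeriodicPt (x := x) hp hp3 hn hnp hnp2 hN
    (by rw [Int.cast_natCast]; exact Function.isPeriodicPt_minimalPeriod _ _)
  have hderiv (r : ℕ) : chebyshevDeriv (n ^ (periodModP p n x * r)) x =
      ((n ^ periodModP p n x : ℕ) : ℤ) ^ r * chebS (((n ^ periodModP p n x : ℕ) : ℤ) ^ r) x := by
    rw [chebyshevDeriv, derivative_T_eval]
    push_cast
    rw [pow_mul]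
  have hl : derivOrder p n x = orderOf (A : ZMod p) := by
    -- The case j = 0 is unconditional: the derivative of T_M at x is A modulo p.
    have h1 := h.derivative_sub 1 0 (by simp)
    have h2 := hderiv 1
    rw [mul_one] at h2
    rw [derivOrder, h2]
    congr 1
    refine ((ZMod.intCast_eq_intCast_iff_dvd_sub _ _ _).2 ?_).symm
    simpa using h1
  have hldvd : derivOrder p n x ∣ p - 1 := by
    rw [hl]
    refine ZMod.orderOf_dvd_card_sub_one fun h0 ↦ h.not_dvd ?_
    exact (ZMod.intCast_zmod_eq_zero_iff_dvd A p).1 h0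
  have hl0 : 0 < derivOrder p n x := Nat.pos_of_dvd_of_pos hldvd (by omega)
  obtain ⟨w, hw⟩ : ∃ w : ℕ, emultiplicity (p : ℤ) (A ^ derivOrder p n x - 1) = w := by
    -- |A| > 1 excludes A^l = 1, so w is finite.
    have h1 : FiniteMultiplicity (p : ℤ) (A ^ derivOrder p n x - 1) :=
      Int.finiteMultiplicity_iff.2 ⟨by simpa using hp.ne_one,
        sub_ne_zero.2 (pow_ne_one_of_one_lt_natAbs h.one_lt hl0.ne')⟩
    exact ⟨_, h1.emultiplicity_eq_multiplicity⟩
  have hw1 : 1 ≤ w := by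
    have h1 : (p : ℤ) ∣ A ^ derivOrder p n x - 1 := by
      rw [← intCast_pow_eq_one_iff, hl, pow_orderOf_eq_one]
    have h2 := le_emultiplicity_of_pow_dvd (k := 1) (by simpa using h1)
    rw [hw] at h2
    exact_mod_cast h2
  have hwmem (t : ℕ) : t ∈ derivExponents p n x ↔ t ≤ w := by
    have h1 : emultiplicity (p : ℤ)
        (chebyshevDeriv (n ^ (periodModP p n x * derivOrder p n x)) x - 1) = w := by
      rw [← hw]
      -- The gain of one power of p in `derivative_sub` makes the two valuations equal.
      refine emultiplicity_eq_of_forall_pow_dvd_sub fun j hj ↦ ?_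
      rw [hderiv, sub_sub_sub_cancel_right]
      exact h.derivative_sub _ _ hj
    rw [derivExponents, Set.mem_ofPred_eq, Int.modEq_comm, Int.modEq_iff_dvd,
      pow_dvd_iff_le_emultiplicity, h1]
    exact Nat.cast_le
  have hS := chebyshevMap_mem_statesOver_iff (k := k) (x := x) hk hinj hxper
  have hcount (L : ℕ) : {X ∈ statesOver p n x k |
      Function.minimalPeriod (chebyshevMap n (p ^ k)) X = L}.ncard =
      periodModP p n x * ((if L = periodModP p n x then 1 else 0) +
        ∑ i ∈ Finset.range (k - 1), if L = periodModP p n x *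
          (derivOrder p n x * p ^ (i + 1 - w)) then (p - 1) * p ^ i else 0) := by
    have h1 := ncard_minimalPeriod_over_cycle (injective_of_forall_mem_periodicPts hper) hinj
      (semiconj_castHom_chebyshevMap hpk n) (x : ZMod p) L
    simp only [mem_statesOver_iff hk]
    rw [h1]
    have h2 := IsLocalModel.ncard_minimalPeriod_eq (x := x) hp (by omega)
      (by simpa [periodModP] using h) hk hl hl0 hw L
    rw [Int.cast_natCast] at h2
    rw [periodModP, ← h2]
    congr 2
    ext X
    refine and_congr_left fun _ ↦ ?_
    rw [← ZMod.intCast_eq_intCast_iff_dvd_sub, eq_comm]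
    simp
  refine ⟨periodModP p n x, derivOrder p n x, w, rfl, rfl, ⟨(hwmem w).2 le_rfl,
    fun t ht ↦ (hwmem t).1 ht⟩, hN, hw1, hldvd, sUnion_weakComponents_functionalGraph hper hS,
    fun hkw ↦ composedOfCycles_functionalGraph hper hS ?_ fun L ↦ ?_,
    fun hkw ↦ composedOfCycles_functionalGraph hper hS ?_ fun L ↦ ?_⟩
  · simp [Multiset.mem_replicate, Multiset.mem_sum, hN.ne', hl0.ne', hp.ne_zero]
    exact hN.ne
  · rw [hcount, mul_count_cycle_lengths_of_lt hp hldvd hw1 hkw]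
  · simp [Multiset.mem_replicate, hN.ne', hl0.ne']
    exact hN.ne
  · rw [hcount, mul_count_cycle_lengths_of_le hp hldvd hkw]
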